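/- Let $\mu$ be a measure on a measurable space $\Omega$, let $\alpha\in\mathbb R\setminus\{0,1\}$, let $f_0,f_1$ be $\mu$-a.e. strictly positive probability densities with respect to $\mu$ (the nominal densities), and let $\epsilon_0,\epsilon_1>0$. For positive probability densities $g,f$ put $$D_\alpha^s(g,f)=\frac{1}{\alpha(1-\alpha)}\int_\Omega (f^\alpha-g^\alpha)(f^{1-\alpha}-g^{1-\alpha})\,d\mu\in[0,\infty],\qquad D_u(g_0,g_1)=\int_\Omega g_1^{u}g_0^{1-u}\,d\mu ,$$ and let $\mathscr G_j$ be the set of $\mu$-a.e. positive probability densities $g$ with $D^s_\alpha(g,f_j)\le\epsilon_j$, $j\in\{0,1\}$. Fix $u\in(0,1)$. For $\mu$-a.e. positive probability densities $\hat g_0,\hat g_1$ and real numbers $\lambda_0,\lambda_1\ge 0$, $\mu_0,\mu_1$, consider the system consisting of the two coupled nonlinear equations, required $\mu$-a.e., $$\frac{\lambda_0}{1-\alpha}\Big(\frac{\hat g_0}{f_0}\Big)^{2\alpha-1}+\Big((1-u)\Big(\frac{\hat g_1}{\hat g_0}\Big)^{u}-\frac{\lambda_0}{\alpha(1-\alpha)}-\mu_0\Big)\Big(\frac{\hat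 g_0}{f_0}\Big)^{\alpha}+\frac{\lambda_0}{\alpha}=0,$$ $$\frac{\lambda_1}{1-\alpha}\Big(\frac{\hat g_1}{f_1}\Big)^{2\alpha-1}+\Big(u\Big(\frac{\hat g_1}{\hat g_0}\Big)^{u-1}-\frac{\lambda_1}{\alpha(1-\alpha)}-\mu_1\Big)\Big(\frac{\hat g_1}{f_1}\Big)^{\alpha}+\frac{\lambda_1}{\alpha}=0,$$ and the constraints $D^s_\alpha(\hat g_j,f_j)\le\epsilon_j$, with $D^s_\alpha(\hat g_j,f_j)=\epsilon_j$ if $\lambda_j\neq 0$, for $j\in\{0,1\}$. Then: 1. Functions $\hat g_0,\hat g_1:\Omega\to\mathbb R$ satisfy $\hat g_0\in\mathscr G_0$, $\hat g_1\in\mathscr G_1$, $D_u(h_0,\hat g_1)\le D_u(\hat g_0,\hat g_1)$ for all $h_0\in\mathscr G_0$ and $D_u(\hat g_0,h_1)\le D_u(\hat g_0,\hat g_1)$ for all $h_1\in\mathscr G_1$ if and only if they solve the system for some $\lambda_0,\mu_0,\lambda_1,\mu_1$. 2. Functions $\hat g_0,\hat g_1$ are least favorable densities with minimizing exponent $u$,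 that is, $\hat g_0\in\mathscr G_0$, $\hat g_1\in\mathscr G_1$ and $D_u(h_0,h_1)\le D_u(\hat g_0,\hat g_1)\le D_v(\hat g_0,\hat g_1)$ for all $(h_0,h_1)\in\mathscr G_0\times\mathscr G_1$ and all $v\in(0,1)$, if and only if they solve the system for some $\lambda_0,\mu_0,\lambda_1,\mu_1$ and $u$ minimizes $v\mapsto D_v(\hat g_0,\hat g_1)$ over $(0,1)$. 3. If $\hat g_0,\hat g_1$ solve the system with $\lambda_0,\mu_0,\lambda_1,\mu_1$ and do not agree $\mu$-a.e., then $\lambda_0,\lambda_1>0$ and $D^s_\alpha(\hat g_j,f_j)=\epsilon_j$ for $j\in\{0,1\}$. In this case the system determines the densities: every pair of densities solving the system (with any multipliers) agrees $\mu$-a.e. with $(\hat g_0,\hat g_1)$. -/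

import Mathlib

open MeasureTheory

/-- `g` is an (almost everywhere) strictly positive probability density with respect to `μ`. -/
structure IsPosDensity {Ω : Type*} [MeasurableSpace Ω] (μ : Measure Ω) (g : Ω → ℝ) : Prop where
  integrable : Integrable g μ
  pos : ∀ᵐ x ∂μ, 0 < g x
  integral_eq_one : ∫ x, g x ∂μ = 1

/-- The `u`-affinity `D_u(G₀, G₁) = ∫ g₁ ^ u * g₀ ^ (1 - u) dμ`. -/
noncomputable def affinity {Ω : Type*} [MeasurableSpace Ω] (μ : Measure Ω) (u : ℝ)
    (g₀ g₁ : Ω → ℝ) : ℝ :=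
  ∫ x, g₁ x ^ u * g₀ x ^ (1 - u) ∂μ

/-- The pointwise integrand of the symmetrized `α`-divergence, at the density values
`a` (of `G`) and `b` (of `F`). -/
noncomputable def symmAlphaIntegrand (α a b : ℝ) : ℝ :=
  1 / (α * (1 - α)) * ((b ^ α - a ^ α) * (b ^ (1 - α) - a ^ (1 - α)))

/-- At positive density values the integrand is nonnegative, so that passing to `ℝ≥0∞`
in `symmAlphaDiv` loses nothing. -/
theorem symmAlphaIntegrand_nonneg (α a b : ℝ) (ha : 0 < a) (hb : 0 < b) :
    0 ≤ symmAlphaIntegrand α a b := by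
  have key : ∀ a b : ℝ, 0 < a → a ≤ b → 0 ≤ symmAlphaIntegrand α a b := by
    intro a b ha hab
    have hb : 0 < b := lt_of_lt_of_le ha hab
    have up : ∀ s : ℝ, 0 ≤ s → 0 ≤ b ^ s - a ^ s := fun s hs =>
      sub_nonneg.2 (Real.rpow_le_rpow ha.le hab hs)
    have down : ∀ s : ℝ, s ≤ 0 → b ^ s - a ^ s ≤ 0 := fun s hs =>
      sub_nonpos.2 (Real.rpow_le_rpow_of_nonpos ha hab hs)
    unfold symmAlphaIntegrand
    rcases le_total 0 α with h0 | h0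
    · rcases le_total α 1 with h1 | h1
      · exact mul_nonneg (one_div_nonneg.2 (mul_nonneg h0 (by linarith)))
          (mul_nonneg (up _ h0) (up _ (by linarith)))
      · exact mul_nonneg_of_nonpos_of_nonpos
          (one_div_nonpos.2 (mul_nonpos_of_nonneg_of_nonpos h0 (by linarith)))
          (mul_nonpos_of_nonneg_of_nonpos (up _ h0) (down _ (by linarith)))
    · exact mul_nonneg_of_nonpos_of_nonpos
        (one_div_nonpos.2 (mul_nonpos_of_nonpos_of_nonneg h0 (by linarith)))
        (mul_nonpos_of_nonpos_of_nonneg (down _ h0) (up _ (by linarith)))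
  rcases le_total a b with h | h
  · exact key a b ha h
  · have := key b a hb h
    unfold symmAlphaIntegrand at this ⊢
    convert this using 2
    ring

/-- The symmetrized `α`-divergence `D_α^s(G, F)`, with values in `[0, ∞]`
(for positive densities `g`, `f` with respect to `μ`). -/
noncomputable def symmAlphaDiv {Ω : Type*} [MeasurableSpace Ω] (μ : Measure Ω) (α : ℝ)
    (g f : Ω → ℝ) : ENNReal :=
  ∫⁻ x, ENNReal.ofReal (symmAlphaIntegrand α (g x) (f x)) ∂μ

/-- The uncertainty class: positive densities in the symmetrized `α`-divergence ball of radius `ε`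
around the nominal density `f`. -/
def symmAlphaNhd {Ω : Type*} [MeasurableSpace Ω] (μ : Measure Ω) (α : ℝ) (f : Ω → ℝ) (ε : ℝ) :
    Set (Ω → ℝ) :=
  {g | IsPosDensity μ g ∧ symmAlphaDiv μ α g f ≤ ENNReal.ofReal ε}

/-- The coupled maximization problems for fixed `u`: `g₀` maximizes `D_u(·, G₁)` over the
class `𝒢₀` and `g₁` maximizes `D_u(G₀, ·)` over the class `𝒢₁`. -/
structure SolvesMaximization {Ω : Type*} [MeasurableSpace Ω] (μ : Measure Ω)
    (𝒢₀ 𝒢₁ : Set (Ω → ℝ)) (u : ℝ) (g₀ g₁ : Ω → ℝ) : Prop where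
  mem₀ : g₀ ∈ 𝒢₀
  mem₁ : g₁ ∈ 𝒢₁
  max₀ : ∀ h₀ ∈ 𝒢₀, affinity μ u h₀ g₁ ≤ affinity μ u g₀ g₁
  max₁ : ∀ h₁ ∈ 𝒢₁, affinity μ u g₀ h₁ ≤ affinity μ u g₀ g₁

/-- `u` minimizes `v ↦ D_v(G₀, G₁)` over `(0, 1)`. -/
def SolvesMinimization {Ω : Type*} [MeasurableSpace Ω] (μ : Measure Ω) (u : ℝ)
    (g₀ g₁ : Ω → ℝ) : Prop :=
  ∀ v ∈ Set.Ioo (0 : ℝ) 1, affinity μ u g₀ g₁ ≤ affinity μ v g₀ g₁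

/-- Least favorable densities `g₀ ∈ 𝒢₀`, `g₁ ∈ 𝒢₁` with minimizing parameter `u`: the saddle value
condition `D_u(H₀, H₁) ≤ D_u(G₀, G₁) ≤ D_v(G₀, G₁)` holds for all
`(H₀, H₁) ∈ 𝒢₀ × 𝒢₁` and `v ∈ (0, 1)`. -/
structure IsLeastFavorable {Ω : Type*} [MeasurableSpace Ω] (μ : Measure Ω)
    (𝒢₀ 𝒢₁ : Set (Ω → ℝ)) (u : ℝ) (g₀ g₁ : Ω → ℝ) : Prop where
  mem₀ : g₀ ∈ 𝒢₀
  mem₁ : g₁ ∈ 𝒢₁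
  max : ∀ h₀ ∈ 𝒢₀, ∀ h₁ ∈ 𝒢₁, affinity μ u h₀ h₁ ≤ affinity μ u g₀ g₁
  min : SolvesMinimization μ u g₀ g₁

/-- The system determining the least favorable densities `g₀, g₁` for given `u`, with multipliers
`l₀, l₁ ≥ 0` (of the divergence constraints) and `m₀, m₁` (of the normalizations): the two coupled
nonlinear equations, together with the constraints and complementary slackness. -/
structure LFDSystem {Ω : Type*} [MeasurableSpace Ω] (μ : Measure Ω) (α : ℝ) (f₀ f₁ : Ω → ℝ)
    (ε₀ ε₁ u : ℝ) (g₀ g₁ : Ω → ℝ) (l₀ m₀ l₁ m₁ : ℝ) : Prop where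
  density₀ : IsPosDensity μ g₀
  density₁ : IsPosDensity μ g₁
  div₀ : symmAlphaDiv μ α g₀ f₀ ≤ ENNReal.ofReal ε₀
  div₁ : symmAlphaDiv μ α g₁ f₁ ≤ ENNReal.ofReal ε₁
  nonneg₀ : 0 ≤ l₀
  nonneg₁ : 0 ≤ l₁
  slack₀ : l₀ = 0 ∨ symmAlphaDiv μ α g₀ f₀ = ENNReal.ofReal ε₀
  slack₁ : l₁ = 0 ∨ symmAlphaDiv μ α g₁ f₁ = ENNReal.ofReal ε₁
  eq₀ : ∀ᵐ x ∂μ,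
    l₀ / (1 - α) * (g₀ x / f₀ x) ^ (2 * α - 1)
      + ((1 - u) * (g₁ x / g₀ x) ^ u - l₀ / (α * (1 - α)) - m₀) * (g₀ x / f₀ x) ^ α
      + l₀ / α = 0
  eq₁ : ∀ᵐ x ∂μ,
    l₁ / (1 - α) * (g₁ x / f₁ x) ^ (2 * α - 1)
      + (u * (g₁ x / g₀ x) ^ (u - 1) - l₁ / (α * (1 - α)) - m₁) * (g₁ x / f₁ x) ^ α
      + l₁ / α = 0

/-!
For fixed `u` the affinity `∫ g₁ ^ u * g₀ ^ (1 - u)` is jointly concave in `(g₀, g₁)` and the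
divergence is strictly convex in its first argument, so the system is the Karush-Kuhn-Tucker system
of a concave maximization problem. Dividing the `j`-th equation by `(g_j / f_j) ^ α` shows that it
says `A_j = m_j + l_j * s (g_j / f_j)`, where `A_j` is the pointwise partial derivative of the
affinity integrand and `s = symmAlphaSlope α` that of the divergence integrand
(`lfd_equation_iff`).

Sufficiency (`LFDSystem.affinity_le`) is a pointwise tangent inequality that is then integrated:
the weighted inequality between means bounds the change of the affinity integrand by
`A₀ * (h₀ - g₀) + A₁ * (h₁ - g₁)`, and the convexity of the divergence integrand bounds this by
`∑ m_j * (h_j - g_j) + l_j * (change of the divergence integrand)`, whose integral is nonpositive by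
complementary slackness. Only the two extreme terms need to be integrable. Since the bound is joint
in both densities, solutions of the coupled maximization problems are joint maximizers. In the case
of equality, strict convexity gives `h_j = g_j` a.e. wherever `l_j > 0`, and `l_j = 0` would make
`g₁ / g₀` constant, hence `g₀ = g₁` a.e. This yields uniqueness.

Necessity (`exists_multipliers_of_affinity_max`) treats one density at a time, the second one
being reduced to the first by the symmetry `u ↦ 1 - u`. A maximizer `g` is perturbed to
`g * (1 + t * η)` with a simple function `η` of `g`-mean zero. As `η` takes finitely many values,
affinity and divergence are finite sums of powers `(1 + t * c) ^ p` along such a perturbation, so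
they are differentiable in `t`. The multipliers then come from linear algebra for three linear
functionals on simple functions, and the equality of functionals is an a.e. equality of functions.
The constraint qualification holds because `f` itself has divergence `0 < ε`.
-/

/-! ### Convexity of the symmetrized divergence integrand -/

/-- The derivative in `a` of `symmAlphaIntegrand α a b`, as a function of the ratio `r = a / b`. -/
noncomputable def symmAlphaSlope (α r : ℝ) : ℝ :=
  1 / (α * (1 - α)) - r ^ (α - 1) / (1 - α) - r ^ (-α) / α

/-- Bernoulli's inequality for all real exponents other than `0` and `1`: the remainder of the
tangent at `1` to `t ↦ t ^ p / (p * (p - 1))` is positive. -/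
theorem bernoulli_rpow_strict {p t : ℝ} (hp₀ : p ≠ 0) (hp₁ : p ≠ 1) (ht : 0 < t) (ht₁ : t ≠ 1) :
    0 < (t ^ p - 1 - p * (t - 1)) / (p * (p - 1)) := by
  have hs : t - 1 ≠ 0 := sub_ne_zero.2 ht₁
  have hts : 1 + (t - 1) = t := by ring
  rcases lt_or_gt_of_ne hp₁ with h1 | h1
  · rcases lt_or_gt_of_ne hp₀ with h0 | h0
    · -- for `p < 0`, use the exponent `1 - p > 1` at the point `t⁻¹`, and multiply by `t`
      have ht' : t⁻¹ - 1 ≠ 0 := sub_ne_zero.2 (by simpa using ht₁)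
      have hti : -1 ≤ t⁻¹ - 1 := by have := inv_pos.2 ht; linarith
      have h := one_add_mul_self_lt_rpow_one_add hti ht' (p := 1 - p) (by linarith)
      rw [show 1 + (t⁻¹ - 1) = t⁻¹ by ring, Real.inv_rpow ht.le, ← Real.rpow_neg ht.le] at h
      have h' := mul_lt_mul_of_pos_right h ht
      rw [show -(1 - p) = p - 1 by ring, Real.rpow_sub_one ht.ne', div_mul_cancel₀ _ ht.ne'] at h'
      have e : (1 + (1 - p) * (t⁻¹ - 1)) * t = 1 + p * (t - 1) := by field_simp; ring
      rw [e] at h'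
      exact div_pos (by linarith) (mul_pos_of_neg_of_neg h0 (by linarith))
    · have h := rpow_one_add_lt_one_add_mul_self (s := t - 1) (by linarith) hs h0 h1
      rw [hts] at h
      exact div_pos_of_neg_of_neg (by linarith) (mul_neg_of_pos_of_neg h0 (by linarith))
  · have h := one_add_mul_self_lt_rpow_one_add (s := t - 1) (by linarith) hs h1
    rw [hts] at h
    exact div_pos (by linarith) (mul_pos (by linarith) (by linarith))

theorem symmAlphaIntegrand_eq {α a b : ℝ} (ha : 0 < a) (hb : 0 < b) :
    symmAlphaIntegrand α a b =
      1 / (α * (1 - α)) * (b + a - a ^ α * b ^ (1 - α) - a ^ (1 - α) * b ^ α) := by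
  have h : ∀ c : ℝ, 0 < c → c ^ α * c ^ (1 - α) = c := fun c hc => by
    rw [← Real.rpow_add hc]; simp
  unfold symmAlphaIntegrand
  have h1 := h a ha
  have h2 := h b hb
  congr 1
  linear_combination h1 + h2

/-- Strict convexity of the integrand, in the form of the tangent inequality. -/
theorem symmAlphaSlope_mul_lt {α a b c : ℝ} (hα₀ : α ≠ 0) (hα₁ : α ≠ 1) (ha : 0 < a) (hb : 0 < b)
    (hc : 0 < c) (hab : b ≠ a) :
    symmAlphaSlope α (a / c) * (b - a) < symmAlphaIntegrand α b c - symmAlphaIntegrand α a c := by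
  obtain ⟨r, hr, rfl⟩ : ∃ r, 0 < r ∧ a = r * c := ⟨a / c, by positivity, by field_simp⟩
  obtain ⟨t, ht, rfl⟩ : ∃ t, 0 < t ∧ b = t * (r * c) := ⟨b / (r * c), by positivity, by field_simp⟩
  have ht₁ : t ≠ 1 := by rintro rfl; simp at hab
  have hα₂ : 1 - α ≠ 0 := sub_ne_zero.2 hα₁.symm
  have B1 := bernoulli_rpow_strict hα₀ hα₁ ht ht₁
  have B2 := bernoulli_rpow_strict hα₂ (by simpa using hα₀) ht ht₁
  have hR := Real.rpow_pos_of_pos hr α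
  have hS := Real.rpow_pos_of_pos hr (1 - α)
  have hRS : r ^ α * r ^ (1 - α) = r := by rw [← Real.rpow_add hr]; simp
  have hcc : c ^ α * c ^ (1 - α) = c := by rw [← Real.rpow_add hc]; simp
  have e1 : r ^ (α - 1) = (r ^ (1 - α))⁻¹ := by rw [← Real.rpow_neg hr.le]; simp
  have e2 : r ^ (-α) = (r ^ α)⁻¹ := Real.rpow_neg hr.le α
  have hpos := add_pos (mul_pos (mul_pos hc hR) B1) (mul_pos (mul_pos hc hS) B2)
  have hrc : r * c / c = r := by field_simp
  have f1 : r * r ^ (α - 1) = r ^ α := by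
    rw [e1]; nth_rw 1 [← hRS]; field_simp
  have f2 : r * r ^ (-α) = r ^ (1 - α) := by
    rw [e2]; nth_rw 1 [← hRS]; field_simp
  rw [symmAlphaIntegrand_eq hb hc, symmAlphaIntegrand_eq ha hc, hrc, ← sub_pos]
  unfold symmAlphaSlope
  rw [Real.mul_rpow ht.le ha.le, Real.mul_rpow ht.le ha.le, Real.mul_rpow hr.le hc.le,
    Real.mul_rpow hr.le hc.le]
  refine hpos.trans_eq ?_
  have k1 : 1 / (1 - α) = 1 / (α * (1 - α)) * α := by field_simp
  have k2 : 1 / α = 1 / (α * (1 - α)) * (1 - α) := by field_simp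
  have k3 : 1 / (α * (α - 1)) = -(1 / (α * (1 - α))) := by
    rw [show α * (α - 1) = -(α * (1 - α)) by ring, one_div, one_div, inv_neg]
  have k4 : 1 / ((1 - α) * (1 - α - 1)) = -(1 / (α * (1 - α))) := by
    rw [show (1 - α) * (1 - α - 1) = -(α * (1 - α)) by ring, one_div, one_div, inv_neg]
  rw [div_eq_mul_one_div (r ^ (α - 1)), div_eq_mul_one_div (r ^ (-α)),
    div_eq_mul_one_div _ (α * (α - 1)), div_eq_mul_one_div _ ((1 - α) * (1 - α - 1)), k1, k2, k3, k4]
  linear_combination -(1 / (α * (1 - α))) * ((-t ^ α * r ^ α - t ^ (1 - α) * r ^ (1 - α) + r ^ α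
    + r ^ (1 - α)) * hcc + (t - 1) * c * (α * f1 + (1 - α) * f2))

theorem symmAlphaSlope_mul_le {α a b c : ℝ} (hα₀ : α ≠ 0) (hα₁ : α ≠ 1) (ha : 0 < a) (hb : 0 < b)
    (hc : 0 < c) :
    symmAlphaSlope α (a / c) * (b - a) ≤ symmAlphaIntegrand α b c - symmAlphaIntegrand α a c := by
  rcases eq_or_ne b a with rfl | h
  · simp
  · exact (symmAlphaSlope_mul_lt hα₀ hα₁ ha hb hc h).le

/-- Dividing the nonlinear equation by `r ^ α` turns it into the stationarity condition
`A = m + l * symmAlphaSlope α r`. -/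
theorem lfd_equation_iff {α l m A r : ℝ} (hr : 0 < r) :
    l / (1 - α) * r ^ (2 * α - 1) + (A - l / (α * (1 - α)) - m) * r ^ α + l / α = 0 ↔
      A = m + l * symmAlphaSlope α r := by
  have h1 : r ^ (2 * α - 1) = r ^ α * r ^ (α - 1) := by rw [← Real.rpow_add hr]; congr 1; ring
  have h2 : r ^ α * r ^ (-α) = 1 := by rw [← Real.rpow_add hr]; simp
  have h3 : l / (1 - α) * r ^ (2 * α - 1) + (A - l / (α * (1 - α)) - m) * r ^ α + l / α =
      r ^ α * (A - (m + l * symmAlphaSlope α r)) := by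
    unfold symmAlphaSlope
    rw [h1]
    linear_combination (-l / α) * h2
  rw [h3, mul_eq_zero, or_iff_right (Real.rpow_pos_of_pos hr α).ne', sub_eq_zero]

/-! ### Integrability, and the divergence as a real integral -/

theorem integrable_rpow_mul_rpow {Ω : Type*} [MeasurableSpace Ω] {μ : Measure Ω} {g₀ g₁ : Ω → ℝ}
    {u : ℝ} (hu : u ∈ Set.Ioo (0 : ℝ) 1) (hg₀ : IsPosDensity μ g₀) (hg₁ : IsPosDensity μ g₁) :
    Integrable (fun x => g₁ x ^ u * g₀ x ^ (1 - u)) μ := by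
  refine Integrable.mono' ((hg₁.integrable.const_mul u).add (hg₀.integrable.const_mul (1 - u)))
    ((hg₁.integrable.aestronglyMeasurable.aemeasurable.pow_const u).mul
      (hg₀.integrable.aestronglyMeasurable.aemeasurable.pow_const (1 - u))).aestronglyMeasurable ?_
  filter_upwards [hg₀.pos, hg₁.pos] with x h0 h1
  rw [Real.norm_of_nonneg (by positivity)]
  exact Real.geom_mean_le_arith_mean2_weighted hu.1.le (by linarith [hu.2]) h1.le h0.le (by ring)

theorem aestronglyMeasurable_symmAlphaIntegrand {Ω : Type*} [MeasurableSpace Ω] {μ : Measure Ω}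
    {f g : Ω → ℝ} (α : ℝ) (hf : IsPosDensity μ f) (hg : IsPosDensity μ g) :
    AEStronglyMeasurable (fun x => symmAlphaIntegrand α (g x) (f x)) μ := by
  have mf := hf.integrable.aestronglyMeasurable.aemeasurable
  have mg := hg.integrable.aestronglyMeasurable.aemeasurable
  exact ((((mf.pow_const α).sub (mg.pow_const α)).mul
    ((mf.pow_const (1 - α)).sub (mg.pow_const (1 - α)))).const_mul _).aestronglyMeasurable

theorem symmAlphaIntegrand_ae_nonneg {Ω : Type*} [MeasurableSpace Ω] {μ : Measure Ω}
    {f g : Ω → ℝ} (α : ℝ) (hf : IsPosDensity μ f) (hg : IsPosDensity μ g) :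
    0 ≤ᵐ[μ] fun x => symmAlphaIntegrand α (g x) (f x) := by
  filter_upwards [hf.pos, hg.pos] with x h1 h2
  exact symmAlphaIntegrand_nonneg α _ _ h2 h1

theorem symmAlphaDiv_eq_ofReal {Ω : Type*} [MeasurableSpace Ω] {μ : Measure Ω} {α : ℝ}
    {f g : Ω → ℝ} (hf : IsPosDensity μ f) (hg : IsPosDensity μ g)
    (hi : Integrable (fun x => symmAlphaIntegrand α (g x) (f x)) μ) :
    symmAlphaDiv μ α g f = ENNReal.ofReal (∫ x, symmAlphaIntegrand α (g x) (f x) ∂μ) :=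
  (ofReal_integral_eq_lintegral_ofReal hi (symmAlphaIntegrand_ae_nonneg α hf hg)).symm

theorem integrable_symmAlphaIntegrand {Ω : Type*} [MeasurableSpace Ω] {μ : Measure Ω} {α ε : ℝ}
    {f g : Ω → ℝ} (hf : IsPosDensity μ f) (hg : IsPosDensity μ g)
    (h : symmAlphaDiv μ α g f ≤ ENNReal.ofReal ε) :
    Integrable (fun x => symmAlphaIntegrand α (g x) (f x)) μ := by
  refine ⟨aestronglyMeasurable_symmAlphaIntegrand α hf hg, ?_⟩
  rw [hasFiniteIntegral_iff_ofReal (symmAlphaIntegrand_ae_nonneg α hf hg)]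
  exact h.trans_lt ENNReal.ofReal_lt_top

theorem mem_symmAlphaNhd_iff {Ω : Type*} [MeasurableSpace Ω] {μ : Measure Ω} {α ε : ℝ}
    {f g : Ω → ℝ} (hf : IsPosDensity μ f) (hε : 0 < ε) :
    g ∈ symmAlphaNhd μ α f ε ↔ IsPosDensity μ g ∧
      Integrable (fun x => symmAlphaIntegrand α (g x) (f x)) μ ∧
      ∫ x, symmAlphaIntegrand α (g x) (f x) ∂μ ≤ ε := by
  constructor
  · rintro ⟨hg, h⟩
    have hi := integrable_symmAlphaIntegrand hf hg h
    rw [symmAlphaDiv_eq_ofReal hf hg hi, ENNReal.ofReal_le_ofReal_iff hε.le] at h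
    exact ⟨hg, hi, h⟩
  · rintro ⟨hg, hi, h⟩
    refine ⟨hg, ?_⟩
    rw [symmAlphaDiv_eq_ofReal hf hg hi]
    exact ENNReal.ofReal_le_ofReal h

/-- A finite divergence makes both mixed terms of the integrand integrable. For `α ∈ (0, 1)` this
holds by the weighted inequality between means; otherwise the mixed terms enter the integrand with
the same positive sign. -/
theorem integrable_mixed_terms {Ω : Type*} [MeasurableSpace Ω] {μ : Measure Ω} {α : ℝ}
    {f g : Ω → ℝ} (hα₀ : α ≠ 0) (hα₁ : α ≠ 1) (hf : IsPosDensity μ f) (hg : IsPosDensity μ g)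
    (hi : Integrable (fun x => symmAlphaIntegrand α (g x) (f x)) μ) :
    Integrable (fun x => g x ^ α * f x ^ (1 - α)) μ ∧
      Integrable (fun x => g x ^ (1 - α) * f x ^ α) μ := by
  have mf := hf.integrable.aestronglyMeasurable.aemeasurable
  have mg := hg.integrable.aestronglyMeasurable.aemeasurable
  have hα₂ : 1 - α ≠ 0 := sub_ne_zero.2 hα₁.symm
  have hsum : Integrable (fun x => f x + g x - α * (1 - α) * symmAlphaIntegrand α (g x) (f x)) μ :=
    (hf.integrable.add hg.integrable).sub (hi.const_mul _)
  have key : ∀ᵐ x ∂μ, f x + g x - α * (1 - α) * symmAlphaIntegrand α (g x) (f x) =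
      g x ^ α * f x ^ (1 - α) + g x ^ (1 - α) * f x ^ α := by
    filter_upwards [hf.pos, hg.pos] with x h1 h2
    rw [symmAlphaIntegrand_eq h2 h1]
    field_simp
    ring
  -- both terms are nonnegative with integrable sum
  constructor
  · refine hsum.mono' ((mg.pow_const _).mul (mf.pow_const _)).aestronglyMeasurable ?_
    filter_upwards [hf.pos, hg.pos, key] with x h1 h2 h3
    rw [h3, Real.norm_of_nonneg (by positivity)]
    have : 0 < g x ^ (1 - α) * f x ^ α := by positivity
    linarith
  · refine hsum.mono' ((mg.pow_const _).mul (mf.pow_const _)).aestronglyMeasurable ?_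
    filter_upwards [hf.pos, hg.pos, key] with x h1 h2 h3
    rw [h3, Real.norm_of_nonneg (by positivity)]
    have : 0 < g x ^ α * f x ^ (1 - α) := by positivity
    linarith

/-! ### Bounded multiplicative perturbations -/

theorem integrable_mul_simpleFunc {Ω : Type*} [MeasurableSpace Ω] {μ : Measure Ω} {k : Ω → ℝ}
    (hk : Integrable k μ) (η : SimpleFunc Ω ℝ) : Integrable (fun x => k x * η x) μ := by
  obtain ⟨C, hC⟩ := η.exists_forall_norm_le
  exact hk.mul_bdd η.measurable.aestronglyMeasurable (Filter.Eventually.of_forall hC)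

theorem integral_mul_map_simpleFunc {Ω : Type*} [MeasurableSpace Ω] {μ : Measure Ω} {k : Ω → ℝ}
    (hk : Integrable k μ) (η : SimpleFunc Ω ℝ) (F : ℝ → ℝ) :
    ∫ x, k x * F (η x) ∂μ = ∑ c ∈ η.range, F c * ∫ x in η ⁻¹' {c}, k x ∂μ := by
  have h : ∀ x, k x * F (η x) = ∑ c ∈ η.range, F c * (η ⁻¹' {c}).indicator k x := by
    intro x
    rw [Finset.sum_eq_single (η x)]
    · simp [mul_comm]
    · intro c _ hc
      rw [Set.indicator_of_notMem (by simpa using hc.symm), mul_zero]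
    · intro h; exact absurd (η.mem_range_self x) h
  simp_rw [h]
  rw [integral_finsetSum _ fun c _ => (hk.indicator (η.measurableSet_preimage {c})).const_mul _]
  refine Finset.sum_congr rfl fun c _ => ?_
  rw [integral_const_mul, integral_indicator (η.measurableSet_preimage {c})]

theorem hasDerivAt_integral_mul_one_add_rpow {Ω : Type*} [MeasurableSpace Ω] {μ : Measure Ω}
    {k : Ω → ℝ} (hk : Integrable k μ) (η : SimpleFunc Ω ℝ) (p : ℝ) :
    HasDerivAt (fun t : ℝ => ∫ x, k x * (1 + t * η x) ^ p ∂μ) (p * ∫ x, k x * η x ∂μ) 0 := by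
  have e1 : (fun t : ℝ => ∫ x, k x * (1 + t * η x) ^ p ∂μ) =
      fun t => ∑ c ∈ η.range, (1 + t * c) ^ p * ∫ x in η ⁻¹' {c}, k x ∂μ := by
    funext t
    exact integral_mul_map_simpleFunc hk η fun c => (1 + t * c) ^ p
  rw [e1, integral_mul_map_simpleFunc hk η fun c => c, Finset.mul_sum]
  refine HasDerivAt.fun_sum fun c _ => ?_
  rw [← mul_assoc]
  refine HasDerivAt.mul_const ?_ _
  have h : HasDerivAt (fun t : ℝ => 1 + t * c) c 0 := by
    simpa using ((hasDerivAt_id (0 : ℝ)).mul_const c).const_add 1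
  simpa [mul_comm] using h.rpow_const (p := p) (Or.inl (by simp))

theorem integrable_mul_one_add_rpow {Ω : Type*} [MeasurableSpace Ω] {μ : Measure Ω}
    {k : Ω → ℝ} (hk : Integrable k μ) (η : SimpleFunc Ω ℝ) (p t : ℝ) :
    Integrable (fun x => k x * (1 + t * η x) ^ p) μ :=
  integrable_mul_simpleFunc hk (η.map fun c => (1 + t * c) ^ p)

theorem eventually_one_add_mul_simpleFunc_pos {Ω : Type*} [MeasurableSpace Ω]
    (η : SimpleFunc Ω ℝ) : ∀ᶠ t : ℝ in nhds 0, ∀ x, 0 < 1 + t * η x := by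
  have h : ∀ᶠ t : ℝ in nhds 0, ∀ c ∈ η.range, 0 < 1 + t * c := by
    refine (Filter.eventually_all_finset _).2 fun c _ => ?_
    have : ContinuousAt (fun t : ℝ => 1 + t * c) 0 := by fun_prop
    exact this.eventually (lt_mem_nhds (by simp))
  filter_upwards [h] with t ht x
  exact ht _ (η.mem_range_self x)

theorem IsPosDensity.mul_one_add {Ω : Type*} [MeasurableSpace Ω] {μ : Measure Ω} {g : Ω → ℝ}
    (hg : IsPosDensity μ g) {η : SimpleFunc Ω ℝ} (hη : ∫ x, g x * η x ∂μ = 0) {t : ℝ}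
    (ht : ∀ x, 0 < 1 + t * η x) : IsPosDensity μ fun x => g x * (1 + t * η x) := by
  have hi := integrable_mul_simpleFunc hg.integrable η
  have e : (fun x => g x * (1 + t * η x)) = fun x => g x + t * (g x * η x) := by
    funext x; ring
  refine ⟨e ▸ hg.integrable.add (hi.const_mul t), ?_, ?_⟩
  · filter_upwards [hg.pos] with x hx using mul_pos hx (ht x)
  · rw [e, integral_add hg.integrable (hi.const_mul t), integral_const_mul, hη,
      hg.integral_eq_one, mul_zero, add_zero]

theorem symmAlphaSlope_mul_self {α a b : ℝ} (ha : 0 < a) (hb : 0 < b) :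
    symmAlphaSlope α (a / b) * a =
      1 / (α * (1 - α)) * a - (1 / (1 - α)) * (a ^ α * b ^ (1 - α))
        - (1 / α) * (a ^ (1 - α) * b ^ α) := by
  have h1 : (a / b) ^ (α - 1) * a = a ^ α * b ^ (1 - α) := by
    rw [Real.div_rpow ha.le hb.le, Real.rpow_sub_one ha.ne', show 1 - α = -(α - 1) by ring,
      Real.rpow_neg hb.le]
    field_simp
  have h2 : (a / b) ^ (-α) * a = a ^ (1 - α) * b ^ α := by
    rw [Real.div_rpow ha.le hb.le, Real.rpow_neg ha.le, Real.rpow_neg hb.le, Real.rpow_sub ha,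
      Real.rpow_one]
    have := Real.rpow_pos_of_pos hb α
    field_simp
  unfold symmAlphaSlope
  linear_combination (-1 / (1 - α)) * h1 + (-1 / α) * h2

theorem integrable_symmAlphaSlope_mul {Ω : Type*} [MeasurableSpace Ω] {μ : Measure Ω} {α : ℝ}
    {f g : Ω → ℝ} (hα₀ : α ≠ 0) (hα₁ : α ≠ 1) (hf : IsPosDensity μ f) (hg : IsPosDensity μ g)
    (hi : Integrable (fun x => symmAlphaIntegrand α (g x) (f x)) μ) :
    Integrable (fun x => symmAlphaSlope α (g x / f x) * g x) μ := by
  obtain ⟨h1, h2⟩ := integrable_mixed_terms hα₀ hα₁ hf hg hi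
  refine (((hg.integrable.const_mul (1 / (α * (1 - α)))).sub (h1.const_mul (1 / (1 - α)))).sub
    (h2.const_mul (1 / α))).congr ?_
  filter_upwards [hf.pos, hg.pos] with x hx hy
  exact (symmAlphaSlope_mul_self hy hx).symm

/-- Along the perturbation `g * (1 + t * η)` the divergence stays finite and is differentiable. -/
theorem symmAlphaIntegrand_perturbation {Ω : Type*} [MeasurableSpace Ω] {μ : Measure Ω} {α : ℝ}
    {f g : Ω → ℝ} (hα₀ : α ≠ 0) (hα₁ : α ≠ 1) (hf : IsPosDensity μ f) (hg : IsPosDensity μ g)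
    (hi : Integrable (fun x => symmAlphaIntegrand α (g x) (f x)) μ) (η : SimpleFunc Ω ℝ) :
    (∀ᶠ t : ℝ in nhds 0,
      Integrable (fun x => symmAlphaIntegrand α (g x * (1 + t * η x)) (f x)) μ) ∧
    HasDerivAt (fun t : ℝ => ∫ x, symmAlphaIntegrand α (g x * (1 + t * η x)) (f x) ∂μ)
      (∫ x, symmAlphaSlope α (g x / f x) * g x * η x ∂μ) 0 := by
  obtain ⟨h1, h2⟩ := integrable_mixed_terms hα₀ hα₁ hf hg hi
  have hα₂ : 1 - α ≠ 0 := sub_ne_zero.2 hα₁.symm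
  set K : ℝ := 1 / (α * (1 - α)) with hK
  -- each summand of the integrand is a fixed integrable function times a power of `1 + t * η`
  have e : ∀ᶠ t : ℝ in nhds 0, (fun x => symmAlphaIntegrand α (g x * (1 + t * η x)) (f x)) =ᵐ[μ]
      fun x => K * (f x + g x * (1 + t * η x) ^ (1 : ℝ)
        - g x ^ α * f x ^ (1 - α) * (1 + t * η x) ^ α
        - g x ^ (1 - α) * f x ^ α * (1 + t * η x) ^ (1 - α)) := by
    filter_upwards [eventually_one_add_mul_simpleFunc_pos η] with t ht
    filter_upwards [hf.pos, hg.pos] with x hx hy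
    rw [symmAlphaIntegrand_eq (mul_pos hy (ht x)) hx, Real.mul_rpow hy.le (ht x).le,
      Real.mul_rpow hy.le (ht x).le, Real.rpow_one]
    ring
  have i0 := fun t : ℝ => integrable_mul_one_add_rpow hg.integrable η 1 t
  have i1 := fun t : ℝ => integrable_mul_one_add_rpow h1 η α t
  have i2 := fun t : ℝ => integrable_mul_one_add_rpow h2 η (1 - α) t
  have i00 : ∀ t : ℝ, Integrable (fun x => f x + g x * (1 + t * η x) ^ (1 : ℝ)) μ :=
    fun t => hf.integrable.add (i0 t)
  have i01 : ∀ t : ℝ, Integrable (fun x => f x + g x * (1 + t * η x) ^ (1 : ℝ)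
      - g x ^ α * f x ^ (1 - α) * (1 + t * η x) ^ α) μ := fun t => (i00 t).sub (i1 t)
  constructor
  · filter_upwards [e] with t ht
    exact (((i01 t).sub (i2 t)).const_mul K).congr ht.symm
  · have d := ((((hasDerivAt_integral_mul_one_add_rpow hg.integrable η 1).const_add
      (∫ x, f x ∂μ)).sub (hasDerivAt_integral_mul_one_add_rpow h1 η α)).sub
      (hasDerivAt_integral_mul_one_add_rpow h2 η (1 - α))).const_mul K
    have j0 := integrable_mul_simpleFunc hg.integrable η
    have j1 := integrable_mul_simpleFunc h1 η
    have j2 := integrable_mul_simpleFunc h2 η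
    have j01 : Integrable (fun x => 1 * (g x * η x) - α * (g x ^ α * f x ^ (1 - α) * η x)) μ :=
      (j0.const_mul _).sub (j1.const_mul _)
    have e' : ∫ x, symmAlphaSlope α (g x / f x) * g x * η x ∂μ =
        K * (1 * ∫ x, g x * η x ∂μ - α * ∫ x, g x ^ α * f x ^ (1 - α) * η x ∂μ
          - (1 - α) * ∫ x, g x ^ (1 - α) * f x ^ α * η x ∂μ) := by
      rw [← integral_const_mul, ← integral_const_mul, ← integral_const_mul,
        ← integral_sub (j0.const_mul _) (j1.const_mul _),
        ← integral_sub j01 (j2.const_mul _),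
        ← integral_const_mul]
      refine integral_congr_ae ?_
      filter_upwards [hf.pos, hg.pos] with x hx hy
      have k1 : 1 / (1 - α) = K * α := by rw [hK]; field_simp
      have k2 : 1 / α = K * (1 - α) := by rw [hK]; field_simp
      simp only [symmAlphaSlope_mul_self hy hx, k1, k2, ← hK]
      ring
    rw [e']
    refine d.congr_of_eventuallyEq ?_
    filter_upwards [e] with t ht
    rw [integral_congr_ae ht, integral_const_mul,
      integral_sub (i01 t) (i2 t), integral_sub (i00 t) (i1 t), integral_add hf.integrable (i0 t)]
    rfl

theorem hasDerivAt_affinity_perturbation {Ω : Type*} [MeasurableSpace Ω] {μ : Measure Ω} {u : ℝ}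
    {g g₁ : Ω → ℝ} (hu : u ∈ Set.Ioo (0 : ℝ) 1) (hg : IsPosDensity μ g) (hg₁ : IsPosDensity μ g₁)
    (η : SimpleFunc Ω ℝ) :
    HasDerivAt (fun t : ℝ => affinity μ u (fun x => g x * (1 + t * η x)) g₁)
      (∫ x, (1 - u) * (g₁ x ^ u * g x ^ (1 - u)) * η x ∂μ) 0 := by
  have d := hasDerivAt_integral_mul_one_add_rpow (integrable_rpow_mul_rpow hu hg hg₁) η (1 - u)
  rw [← integral_const_mul] at d
  simp_rw [← mul_assoc] at d ⊢
  refine d.congr_of_eventuallyEq ?_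
  filter_upwards [eventually_one_add_mul_simpleFunc_pos η] with t ht
  refine integral_congr_ae ?_
  filter_upwards [hg.pos] with x hx
  rw [Real.mul_rpow hx.le (ht x).le, mul_assoc]

/-! ### Lagrange multipliers -/

theorem HasDerivAt.eventually_lt_right {φ : ℝ → ℝ} {d : ℝ} (h : HasDerivAt φ d 0) (hd : d < 0) :
    ∀ᶠ t in nhdsWithin 0 (Set.Ioi 0), φ t < φ 0 := by
  have hs := (hasDerivAt_iff_tendsto_slope_zero.1 h).mono_left
    (nhdsWithin_mono 0 fun x (hx : 0 < x) => hx.ne')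
  filter_upwards [hs.eventually (gt_mem_nhds hd), self_mem_nhdsWithin] with t ht (ht0 : 0 < t)
  simp only [zero_add, smul_eq_mul] at ht
  have := neg_of_mul_neg_right ht (inv_pos.2 ht0).le
  linarith

theorem HasDerivAt.nonpos_of_eventually_le_right {φ : ℝ → ℝ} {d : ℝ} (h : HasDerivAt φ d 0)
    (hle : ∀ᶠ t in nhdsWithin 0 (Set.Ioi 0), φ t ≤ φ 0) : d ≤ 0 := by
  by_contra! hd
  obtain ⟨t, h1, h2⟩ := ((h.neg.eventually_lt_right (by linarith)).and hle).exists
  simp only [Pi.neg_apply] at h1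
  linarith

/-- The multiplier rule for linear functionals: an inequality constraint `B`, an equality
constraint `G`, and a direction `v₀` that satisfies the former strictly. -/
theorem exists_multipliers_of_strict_direction {V : Type*} [AddCommGroup V] [Module ℝ V]
    (G B A : V →ₗ[ℝ] ℝ) (h : ∀ v, G v = 0 → B v < 0 → A v ≤ 0) {v₀ : V} (hG : G v₀ = 0)
    (hB : B v₀ < 0) : ∃ m l : ℝ, 0 ≤ l ∧ A = m • G + l • B := by
  have h0 : A v₀ ≤ 0 := h v₀ hG hB
  have hle : ∀ v, G v = 0 → B v = 0 → A v ≤ 0 := by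
    intro v h1 h2
    by_contra! hv
    -- moving slightly from `v` in the direction `v₀` keeps `A` positive
    have hc : ∃ s : ℝ, 0 < s ∧ 0 < A v + s * A v₀ := by
      refine ⟨A v / (2 * (1 - A v₀)), by apply div_pos <;> linarith, ?_⟩
      have hp : 0 < 2 * (1 - A v₀) := by linarith
      have hne : 1 - A v₀ ≠ 0 := by linarith
      rw [show A v + A v / (2 * (1 - A v₀)) * A v₀ = A v * (2 - A v₀) / (2 * (1 - A v₀)) by
        field_simp; ring]
      exact div_pos (mul_pos hv (by linarith)) hp
    obtain ⟨s, hs, hs'⟩ := hc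
    have := h (v + s • v₀) (by simp [h1, hG]) (by simp [h2]; exact mul_neg_of_pos_of_neg hs hB)
    simp only [map_add, map_smul, smul_eq_mul] at this
    linarith
  have hker : ⨅ i, LinearMap.ker (![G, B] i) ≤ LinearMap.ker A := by
    intro v hv
    simp only [Submodule.mem_iInf, Fin.forall_fin_two, LinearMap.mem_ker] at hv
    simp only [Matrix.cons_val_zero, Matrix.cons_val_one] at hv
    have h1 := hle v hv.1 hv.2
    have h2 := hle (-v) (by simp [hv.1]) (by simp [hv.2])
    rw [map_neg] at h2
    rw [LinearMap.mem_ker]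
    linarith
  have hs := mem_span_of_iInf_ker_le_ker hker
  obtain ⟨c, hc⟩ := (Submodule.mem_span_range_iff_exists_fun ℝ).1 hs
  rw [Fin.sum_univ_two] at hc
  simp only [Matrix.cons_val_zero, Matrix.cons_val_one] at hc
  refine ⟨c 0, c 1, ?_, hc.symm⟩
  rw [← hc] at h0
  simp only [LinearMap.add_apply, LinearMap.smul_apply, hG, smul_eq_mul, mul_zero, zero_add] at h0
  exact nonneg_of_mul_nonpos_left h0 hB

theorem exists_multiplier_of_ker_le {V : Type*} [AddCommGroup V] [Module ℝ V]
    (G A : V →ₗ[ℝ] ℝ) (h : ∀ v, G v = 0 → A v ≤ 0) : ∃ m : ℝ, A = m • G := by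
  have hker : ⨅ _ : Unit, LinearMap.ker G ≤ LinearMap.ker A := by
    intro v hv
    simp only [ciInf_const, LinearMap.mem_ker] at hv
    have h2 := h (-v) (by simp [hv])
    rw [map_neg] at h2
    rw [LinearMap.mem_ker]
    linarith [h v hv]
  obtain ⟨c, hc⟩ := (Submodule.mem_span_range_iff_exists_fun ℝ).1
    (mem_span_of_iInf_ker_le_ker (L := fun _ : Unit => G) hker)
  exact ⟨c (), by simpa using hc.symm⟩

/-- The linear functional `η ↦ ∫ k * η` on simple functions. -/
noncomputable def simpleFuncPairing {Ω : Type*} [MeasurableSpace Ω] (μ : Measure Ω) (k : Ω → ℝ)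
    (hk : Integrable k μ) : SimpleFunc Ω ℝ →ₗ[ℝ] ℝ where
  toFun η := ∫ x, k x * η x ∂μ
  map_add' η ζ := by
    rw [← integral_add (integrable_mul_simpleFunc hk η) (integrable_mul_simpleFunc hk ζ)]
    simp [mul_add]
  map_smul' c η := by
    rw [RingHom.id_apply, smul_eq_mul, ← integral_const_mul]
    simp [mul_left_comm]

theorem ae_eq_of_simpleFuncPairing_eq {Ω : Type*} [MeasurableSpace Ω] {μ : Measure Ω}
    {k k' : Ω → ℝ} (hk : Integrable k μ) (hk' : Integrable k' μ)
    (h : ∀ η : SimpleFunc Ω ℝ, ∫ x, k x * η x ∂μ = ∫ x, k' x * η x ∂μ) : k =ᵐ[μ] k' := by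
  refine Integrable.ae_eq_of_forall_setIntegral_eq _ _ hk hk' fun s hs _ => ?_
  have := h (SimpleFunc.piecewise s hs (SimpleFunc.const Ω 1) (SimpleFunc.const Ω 0))
  have e : ∀ (j : Ω → ℝ) (x : Ω),
      j x * SimpleFunc.piecewise s hs (SimpleFunc.const Ω (1 : ℝ)) (SimpleFunc.const Ω 0) x =
        s.indicator j x := by
    intro j x
    by_cases hx : x ∈ s <;> simp [hx]
  simp_rw [e] at this
  rwa [integral_indicator hs, integral_indicator hs] at this

/-- Necessity of the multiplier equation in one variable. If the divergence constraint is inactive,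
all small mean-zero perturbations are feasible. If it is active, then some mean-zero perturbation strictly
decreases the divergence: otherwise the slope of the integrand would be constant along `g`, and the
tangent inequality at `f` would give divergence `0 < ε`. -/
theorem exists_multipliers_of_affinity_max {Ω : Type*} [MeasurableSpace Ω] {μ : Measure Ω}
    {α ε u : ℝ} {f g g₁ : Ω → ℝ} (hα₀ : α ≠ 0) (hα₁ : α ≠ 1) (hf : IsPosDensity μ f) (hε : 0 < ε)
    (hu : u ∈ Set.Ioo (0 : ℝ) 1) (hg₁ : IsPosDensity μ g₁) (hmem : g ∈ symmAlphaNhd μ α f ε)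
    (hmax : ∀ h ∈ symmAlphaNhd μ α f ε, affinity μ u h g₁ ≤ affinity μ u g g₁) :
    ∃ l m : ℝ, 0 ≤ l ∧ (l = 0 ∨ symmAlphaDiv μ α g f = ENNReal.ofReal ε) ∧
      ∀ᵐ x ∂μ, (1 - u) * (g₁ x / g x) ^ u = m + l * symmAlphaSlope α (g x / f x) := by
  obtain ⟨hg, hi, hle⟩ := (mem_symmAlphaNhd_iff hf hε).1 hmem
  have iB := integrable_symmAlphaSlope_mul hα₀ hα₁ hf hg hi
  have iA : Integrable (fun x => (1 - u) * (g₁ x ^ u * g x ^ (1 - u))) μ :=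
    (integrable_rpow_mul_rpow hu hg hg₁).const_mul (1 - u)
  have hA : ∀ᵐ x ∂μ, (1 - u) * (g₁ x ^ u * g x ^ (1 - u)) =
      (1 - u) * (g₁ x / g x) ^ u * g x := by
    filter_upwards [hg.pos, hg₁.pos] with x h0 h1
    rw [Real.div_rpow h1.le h0.le, Real.rpow_sub h0, Real.rpow_one]
    have := Real.rpow_pos_of_pos h0 u
    field_simp
  -- feasible directions are not ascent directions
  have hdir : ∀ η : SimpleFunc Ω ℝ, ∫ x, g x * η x ∂μ = 0 →
      (∀ᶠ t in nhdsWithin (0 : ℝ) (Set.Ioi 0),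
        ∫ x, symmAlphaIntegrand α (g x * (1 + t * η x)) (f x) ∂μ ≤ ε) →
      ∫ x, (1 - u) * (g₁ x ^ u * g x ^ (1 - u)) * η x ∂μ ≤ 0 := by
    intro η hη hfeas
    refine (hasDerivAt_affinity_perturbation hu hg hg₁ η).nonpos_of_eventually_le_right ?_
    filter_upwards [hfeas, (eventually_one_add_mul_simpleFunc_pos η).filter_mono nhdsWithin_le_nhds,
      (symmAlphaIntegrand_perturbation hα₀ hα₁ hf hg hi η).1.filter_mono nhdsWithin_le_nhds]
      with t h1 h2 h3
    simpa using hmax _ ((mem_symmAlphaNhd_iff hf hε).2 ⟨hg.mul_one_add hη h2, h3, h1⟩)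
  rcases hle.lt_or_eq with hlt | heq
  · obtain ⟨m, hm⟩ := exists_multiplier_of_ker_le (simpleFuncPairing μ g hg.integrable)
      (simpleFuncPairing μ _ iA) fun η hη => hdir η hη <| by
        have hc := (symmAlphaIntegrand_perturbation hα₀ hα₁ hf hg hi η).2.continuousAt
        filter_upwards [(hc.eventually (gt_mem_nhds (by simpa using hlt))).filter_mono
          nhdsWithin_le_nhds] with t ht using ht.le
    refine ⟨0, m, le_rfl, Or.inl rfl, ?_⟩
    have h := ae_eq_of_simpleFuncPairing_eq iA (hg.integrable.const_mul m) fun η => by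
      have := LinearMap.congr_fun hm η
      simp_rw [mul_assoc m]
      rw [integral_const_mul]
      exact this
    filter_upwards [h, hA, hg.pos] with x h1 h2 h3
    rw [h2] at h1
    simpa using mul_right_cancel₀ h3.ne' h1
  · have hact : symmAlphaDiv μ α g f = ENNReal.ofReal ε := by
      rw [symmAlphaDiv_eq_ofReal hf hg hi, heq]
    obtain ⟨v₀, hv₀, hv₀'⟩ : ∃ v₀ : SimpleFunc Ω ℝ,
        simpleFuncPairing μ g hg.integrable v₀ = 0 ∧ simpleFuncPairing μ _ iB v₀ < 0 := by
      by_contra! hno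
      obtain ⟨m, hm⟩ := exists_multiplier_of_ker_le (simpleFuncPairing μ g hg.integrable)
        (-simpleFuncPairing μ _ iB) fun v hv => by
          simpa using hno v hv
      have h := ae_eq_of_simpleFuncPairing_eq iB (hg.integrable.const_mul (-m)) fun η => by
        have := LinearMap.congr_fun hm η
        simp_rw [mul_assoc (-m)]
        rw [integral_const_mul, neg_mul, eq_neg_iff_add_eq_zero, ← neg_eq_iff_add_eq_zero]
        exact this
      have hpt : ∀ᵐ x ∂μ, symmAlphaIntegrand α (g x) (f x) ≤ m * (f x - g x) := by
        filter_upwards [h, hf.pos, hg.pos] with x h1 h2 h3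
        have h4 := symmAlphaSlope_mul_le hα₀ hα₁ h3 h2 h2
        rw [mul_right_cancel₀ h3.ne' h1] at h4
        have h5 : symmAlphaIntegrand α (f x) (f x) = 0 := by simp [symmAlphaIntegrand]
        rw [h5] at h4
        linarith
      have h6 := integral_mono_ae hi ((hf.integrable.sub hg.integrable).const_mul m) hpt
      simp only [Pi.sub_apply] at h6
      rw [integral_const_mul, integral_sub hf.integrable hg.integrable, hf.integral_eq_one,
        hg.integral_eq_one] at h6
      linarith
    obtain ⟨m, l, hl, hml⟩ := exists_multipliers_of_strict_direction
      (simpleFuncPairing μ g hg.integrable) (simpleFuncPairing μ _ iB) (simpleFuncPairing μ _ iA)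
      (fun η hη hη' => hdir η hη <| by
        have hd := (symmAlphaIntegrand_perturbation hα₀ hα₁ hf hg hi η).2
        filter_upwards [hd.eventually_lt_right hη'] with t ht
        refine ht.le.trans ?_
        simpa using hle) hv₀ hv₀'
    refine ⟨l, m, hl, Or.inr hact, ?_⟩
    have h := ae_eq_of_simpleFuncPairing_eq iA ((hg.integrable.const_mul m).add (iB.const_mul l))
      fun η => by
        have := LinearMap.congr_fun hml η
        simp only [Pi.add_apply, add_mul]
        simp_rw [mul_assoc m, mul_assoc l]
        rw [integral_add ((integrable_mul_simpleFunc hg.integrable η).const_mul m)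
          ((integrable_mul_simpleFunc iB η).const_mul l), integral_const_mul, integral_const_mul]
        exact this
    filter_upwards [h, hA, hg.pos] with x h1 h2 h3
    rw [h2] at h1
    refine mul_right_cancel₀ h3.ne' ?_
    rw [h1]
    simp only [Pi.add_apply]
    ring

theorem affinity_symm {Ω : Type*} [MeasurableSpace Ω] (μ : Measure Ω) (u : ℝ) (g₀ g₁ : Ω → ℝ) :
    affinity μ (1 - u) g₁ g₀ = affinity μ u g₀ g₁ := by
  unfold affinity
  congr 1
  funext x
  rw [sub_sub_cancel, mul_comm]

/-- Exchanging the two densities turns the second stationarity coefficient into the first. -/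
theorem div_rpow_sub_one_eq {a b u : ℝ} (ha : 0 < a) (hb : 0 < b) :
    (b / a) ^ (u - 1) = (a / b) ^ (1 - u) := by
  rw [← inv_div, Real.inv_rpow (by positivity), ← Real.rpow_neg (by positivity)]
  congr 1
  ring

theorem LFDSystem.stationary {Ω : Type*} [MeasurableSpace Ω] {μ : Measure Ω}
    {α ε₀ ε₁ u l₀ m₀ l₁ m₁ : ℝ} {f₀ f₁ g₀ g₁ : Ω → ℝ}
    (hf₀ : IsPosDensity μ f₀) (hf₁ : IsPosDensity μ f₁)
    (S : LFDSystem μ α f₀ f₁ ε₀ ε₁ u g₀ g₁ l₀ m₀ l₁ m₁) :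
    (∀ᵐ x ∂μ, (1 - u) * (g₁ x / g₀ x) ^ u = m₀ + l₀ * symmAlphaSlope α (g₀ x / f₀ x)) ∧
      ∀ᵐ x ∂μ, u * (g₁ x / g₀ x) ^ (u - 1) = m₁ + l₁ * symmAlphaSlope α (g₁ x / f₁ x) := by
  constructor
  · filter_upwards [S.eq₀, hf₀.pos, S.density₀.pos] with x h h1 h2
    exact (lfd_equation_iff (div_pos h2 h1)).1 h
  · filter_upwards [S.eq₁, hf₁.pos, S.density₁.pos] with x h h1 h2
    exact (lfd_equation_iff (div_pos h2 h1)).1 h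

theorem exists_lfdSystem_of_solvesMaximization {Ω : Type*} [MeasurableSpace Ω] {μ : Measure Ω}
    {α ε₀ ε₁ u : ℝ} {f₀ f₁ g₀ g₁ : Ω → ℝ} (hα₀ : α ≠ 0) (hα₁ : α ≠ 1)
    (hf₀ : IsPosDensity μ f₀) (hf₁ : IsPosDensity μ f₁) (hε₀ : 0 < ε₀) (hε₁ : 0 < ε₁)
    (hu : u ∈ Set.Ioo (0 : ℝ) 1)
    (H : SolvesMaximization μ (symmAlphaNhd μ α f₀ ε₀) (symmAlphaNhd μ α f₁ ε₁) u g₀ g₁) :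
    ∃ l₀ m₀ l₁ m₁ : ℝ, LFDSystem μ α f₀ f₁ ε₀ ε₁ u g₀ g₁ l₀ m₀ l₁ m₁ := by
  have d₀ := H.mem₀.1
  have d₁ := H.mem₁.1
  obtain ⟨l₀, m₀, hl₀, hs₀, he₀⟩ :=
    exists_multipliers_of_affinity_max hα₀ hα₁ hf₀ hε₀ hu d₁ H.mem₀ H.max₀
  have hu' : 1 - u ∈ Set.Ioo (0 : ℝ) 1 := ⟨by linarith [hu.2], by linarith [hu.1]⟩
  obtain ⟨l₁, m₁, hl₁, hs₁, he₁⟩ :=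
    exists_multipliers_of_affinity_max hα₀ hα₁ hf₁ hε₁ hu' d₀ H.mem₁ fun h hh => by
      rw [affinity_symm, affinity_symm]
      exact H.max₁ h hh
  refine ⟨l₀, m₀, l₁, m₁, d₀, d₁, H.mem₀.2, H.mem₁.2, hl₀, hl₁, hs₀, hs₁, ?_, ?_⟩
  · filter_upwards [he₀, hf₀.pos, d₀.pos] with x h h1 h2
    exact (lfd_equation_iff (div_pos h2 h1)).2 h
  · filter_upwards [he₁, hf₁.pos, d₀.pos, d₁.pos] with x h h1 h2 h3
    rw [sub_sub_cancel, ← div_rpow_sub_one_eq h2 h3] at h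
    exact (lfd_equation_iff (div_pos h3 h1)).2 h

/-! ### Sufficiency of the system, and uniqueness -/

/-- The tangent plane inequality for the jointly concave, homogeneous function
`(a, b) ↦ b ^ u * a ^ (1 - u)`. -/
theorem rpow_mul_rpow_sub_le {a b c d u : ℝ} (hu : u ∈ Set.Ioo (0 : ℝ) 1) (ha : 0 < a) (hb : 0 < b)
    (hc : 0 < c) (hd : 0 < d) :
    d ^ u * c ^ (1 - u) - b ^ u * a ^ (1 - u) ≤
      (1 - u) * (b / a) ^ u * (c - a) + u * (b / a) ^ (u - 1) * (d - b) := by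
  have hba : 0 < b / a := div_pos hb ha
  have hP := Real.rpow_pos_of_pos hba u
  -- the inequality between weighted means for `d / b` and `c / a`, scaled by `b ^ u * a ^ (1 - u)`
  have h := mul_le_mul_of_nonneg_left (Real.geom_mean_le_arith_mean2_weighted hu.1.le
    (by linarith [hu.2] : 0 ≤ 1 - u) (div_pos hd hb).le (div_pos hc ha).le (by ring))
    (mul_pos (Real.rpow_pos_of_pos hb u) (Real.rpow_pos_of_pos ha (1 - u))).le
  have hbu := Real.rpow_pos_of_pos hb u
  have hau := Real.rpow_pos_of_pos ha u
  have hau' := Real.rpow_pos_of_pos ha (1 - u)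
  have e1 : b ^ u * a ^ (1 - u) * ((d / b) ^ u * (c / a) ^ (1 - u)) = d ^ u * c ^ (1 - u) := by
    rw [Real.div_rpow hd.le hb.le, Real.div_rpow hc.le ha.le]
    field_simp
  have e2 : b ^ u * a ^ (1 - u) = (b / a) ^ u * a := by
    rw [Real.div_rpow hb.le ha.le, Real.rpow_sub ha, Real.rpow_one]
    field_simp
  rw [e1, e2] at h
  rw [e2, Real.rpow_sub_one hba.ne']
  refine (sub_le_sub_right h _).trans_eq ?_
  field_simp
  ring

/-- A solution of the system maximizes the affinity jointly, and any other joint maximizer has the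
same `j`-th density when the `j`-th multiplier is positive. -/
theorem LFDSystem.affinity_le {Ω : Type*} [MeasurableSpace Ω] {μ : Measure Ω}
    {α ε₀ ε₁ u l₀ m₀ l₁ m₁ : ℝ} {f₀ f₁ g₀ g₁ h₀ h₁ : Ω → ℝ} (hα₀ : α ≠ 0) (hα₁ : α ≠ 1)
    (hf₀ : IsPosDensity μ f₀) (hf₁ : IsPosDensity μ f₁) (hε₀ : 0 < ε₀) (hε₁ : 0 < ε₁)
    (hu : u ∈ Set.Ioo (0 : ℝ) 1) (S : LFDSystem μ α f₀ f₁ ε₀ ε₁ u g₀ g₁ l₀ m₀ l₁ m₁)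
    (H₀ : h₀ ∈ symmAlphaNhd μ α f₀ ε₀) (H₁ : h₁ ∈ symmAlphaNhd μ α f₁ ε₁) :
    affinity μ u h₀ h₁ ≤ affinity μ u g₀ g₁ ∧
      (affinity μ u g₀ g₁ ≤ affinity μ u h₀ h₁ →
        (0 < l₀ → h₀ =ᵐ[μ] g₀) ∧ (0 < l₁ → h₁ =ᵐ[μ] g₁)) := by
  obtain ⟨s₀, s₁⟩ := S.stationary hf₀ hf₁
  have d₀ := S.density₀
  have d₁ := S.density₁
  obtain ⟨k₀, j₀, b₀⟩ := (mem_symmAlphaNhd_iff hf₀ hε₀).1 H₀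
  obtain ⟨k₁, j₁, b₁⟩ := (mem_symmAlphaNhd_iff hf₁ hε₁).1 H₁
  have i₀ := integrable_symmAlphaIntegrand hf₀ d₀ S.div₀
  have i₁ := integrable_symmAlphaIntegrand hf₁ d₁ S.div₁
  -- complementary slackness bounds the contribution of each divergence constraint
  have slack : ∀ {l ε : ℝ} {f g h : Ω → ℝ}, IsPosDensity μ f → IsPosDensity μ g → 0 < ε →
      Integrable (fun x => symmAlphaIntegrand α (g x) (f x)) μ → 0 ≤ l →
      (l = 0 ∨ symmAlphaDiv μ α g f = ENNReal.ofReal ε) →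
      ∫ x, symmAlphaIntegrand α (h x) (f x) ∂μ ≤ ε →
      l * (∫ x, symmAlphaIntegrand α (h x) (f x) ∂μ
        - ∫ x, symmAlphaIntegrand α (g x) (f x) ∂μ) ≤ 0 := by
    intro l ε f g h hf hg hε hi hl hs hb
    rcases hs with rfl | hs
    · simp
    · rw [symmAlphaDiv_eq_ofReal hf hg hi, ENNReal.ofReal_eq_ofReal_iff
        (integral_nonneg_of_ae (symmAlphaIntegrand_ae_nonneg α hf hg)) hε.le] at hs
      exact mul_nonpos_of_nonneg_of_nonpos hl (by linarith)
  have c₀ := slack hf₀ d₀ hε₀ i₀ S.nonneg₀ S.slack₀ b₀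
  have c₁ := slack hf₁ d₁ hε₁ i₁ S.nonneg₁ S.slack₁ b₁
  set X₀ : Ω → ℝ := fun x => m₀ * (h₀ x - g₀ x) +
    l₀ * (symmAlphaIntegrand α (h₀ x) (f₀ x) - symmAlphaIntegrand α (g₀ x) (f₀ x)) with hX₀
  set X₁ : Ω → ℝ := fun x => m₁ * (h₁ x - g₁ x) +
    l₁ * (symmAlphaIntegrand α (h₁ x) (f₁ x) - symmAlphaIntegrand α (g₁ x) (f₁ x)) with hX₁
  have int : ∀ {l m : ℝ} {f g h : Ω → ℝ}, IsPosDensity μ g → IsPosDensity μ h →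
      Integrable (fun x => symmAlphaIntegrand α (g x) (f x)) μ →
      Integrable (fun x => symmAlphaIntegrand α (h x) (f x)) μ →
      Integrable (fun x => m * (h x - g x) +
        l * (symmAlphaIntegrand α (h x) (f x) - symmAlphaIntegrand α (g x) (f x))) μ ∧
      ∫ x, m * (h x - g x) +
        l * (symmAlphaIntegrand α (h x) (f x) - symmAlphaIntegrand α (g x) (f x)) ∂μ =
      l * (∫ x, symmAlphaIntegrand α (h x) (f x) ∂μ
        - ∫ x, symmAlphaIntegrand α (g x) (f x) ∂μ) := by
    intro l m f g h hg hh hi hj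
    have t1 : Integrable (fun x => m * (h x - g x)) μ :=
      (hh.integrable.sub hg.integrable).const_mul m
    have t2 : Integrable (fun x =>
        l * (symmAlphaIntegrand α (h x) (f x) - symmAlphaIntegrand α (g x) (f x))) μ :=
      (hj.sub hi).const_mul l
    refine ⟨t1.add t2, ?_⟩
    rw [integral_add t1 t2, integral_const_mul, integral_const_mul,
      integral_sub hh.integrable hg.integrable, integral_sub hj hi, hh.integral_eq_one,
      hg.integral_eq_one, sub_self, mul_zero, zero_add]
  obtain ⟨p₀, q₀⟩ := int (l := l₀) (m := m₀) d₀ k₀ i₀ j₀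
  obtain ⟨p₁, q₁⟩ := int (l := l₁) (m := m₁) d₁ k₁ i₁ j₁
  have tang : ∀ {l m A a b c : ℝ}, 0 ≤ l → 0 < a → 0 < b → 0 < c →
      A = m + l * symmAlphaSlope α (a / c) →
      A * (b - a) ≤ m * (b - a) + l * (symmAlphaIntegrand α b c - symmAlphaIntegrand α a c) := by
    intro l m A a b c hl ha hb hc hA
    have := mul_le_mul_of_nonneg_left (symmAlphaSlope_mul_le hα₀ hα₁ ha hb hc) hl
    rw [hA]
    linarith
  have tang' : ∀ {l m A a b c : ℝ}, 0 < l → 0 < a → 0 < b → 0 < c →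
      A = m + l * symmAlphaSlope α (a / c) →
      m * (b - a) + l * (symmAlphaIntegrand α b c - symmAlphaIntegrand α a c) ≤ A * (b - a) →
      b = a := by
    intro l m A a b c hl ha hb hc hA hle
    by_contra hne
    have := mul_lt_mul_of_pos_left (symmAlphaSlope_mul_lt hα₀ hα₁ ha hb hc hne) hl
    rw [hA] at hle
    linarith
  have iw := integrable_rpow_mul_rpow hu d₀ d₁
  have iw' := integrable_rpow_mul_rpow hu k₀ k₁
  have pt : ∀ᵐ x ∂μ, h₁ x ^ u * h₀ x ^ (1 - u) - g₁ x ^ u * g₀ x ^ (1 - u) ≤ X₀ x + X₁ x := by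
    filter_upwards [s₀, s₁, d₀.pos, d₁.pos, k₀.pos, k₁.pos, hf₀.pos, hf₁.pos]
      with x e₀ e₁ a₀ a₁ a₂ a₃ a₄ a₅
    have := rpow_mul_rpow_sub_le hu a₀ a₁ a₂ a₃
    have := tang S.nonneg₀ a₀ a₂ a₄ e₀
    have := tang S.nonneg₁ a₁ a₃ a₅ e₁
    simp only [hX₀, hX₁]
    linarith
  have iX : ∫ x, X₀ x + X₁ x ∂μ ≤ 0 := by
    rw [integral_add p₀ p₁, q₀, q₁]
    linarith
  have idiff : Integrable
      (fun x => h₁ x ^ u * h₀ x ^ (1 - u) - g₁ x ^ u * g₀ x ^ (1 - u)) μ := iw'.sub iw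
  have ediff : ∫ x, h₁ x ^ u * h₀ x ^ (1 - u) - g₁ x ^ u * g₀ x ^ (1 - u) ∂μ =
      affinity μ u h₀ h₁ - affinity μ u g₀ g₁ := integral_sub iw' iw
  have hmono := integral_mono_ae idiff (p₀.add p₁) pt
  change _ ≤ ∫ x, X₀ x + X₁ x ∂μ at hmono
  rw [ediff] at hmono
  refine ⟨by linarith, fun hge => ?_⟩
  -- equality of the affinities forces equality in the tangent inequalities almost everywhere
  have heq : (fun x => h₁ x ^ u * h₀ x ^ (1 - u) - g₁ x ^ u * g₀ x ^ (1 - u)) =ᵐ[μ]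
      fun x => X₀ x + X₁ x :=
    (integral_eq_iff_of_ae_le idiff (p₀.add p₁) pt).1 (by
      change _ = ∫ x, X₀ x + X₁ x ∂μ
      rw [ediff]
      linarith)
  constructor
  · intro hl
    filter_upwards [heq, s₀, s₁, d₀.pos, d₁.pos, k₀.pos, k₁.pos, hf₀.pos, hf₁.pos]
      with x e e₀ e₁ a₀ a₁ a₂ a₃ a₄ a₅
    have := rpow_mul_rpow_sub_le hu a₀ a₁ a₂ a₃
    have := tang S.nonneg₁ a₁ a₃ a₅ e₁
    simp only [hX₀, hX₁] at e
    exact tang' hl a₀ a₂ a₄ e₀ (by linarith)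
  · intro hl
    filter_upwards [heq, s₀, s₁, d₀.pos, d₁.pos, k₀.pos, k₁.pos, hf₀.pos, hf₁.pos]
      with x e e₀ e₁ a₀ a₁ a₂ a₃ a₄ a₅
    have := rpow_mul_rpow_sub_le hu a₀ a₁ a₂ a₃
    have := tang S.nonneg₀ a₀ a₂ a₄ e₀
    simp only [hX₀, hX₁] at e
    exact tang' hl a₁ a₃ a₅ e₁ (by linarith)

/-- Two positive densities with a constant ratio agree, as both integrate to `1`. -/
theorem IsPosDensity.ae_eq_of_div_rpow_const {Ω : Type*} [MeasurableSpace Ω] {μ : Measure Ω}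
    {g₀ g₁ : Ω → ℝ} (h₀ : IsPosDensity μ g₀) (h₁ : IsPosDensity μ g₁) {p c : ℝ} (hp : p ≠ 0)
    (h : ∀ᵐ x ∂μ, (g₁ x / g₀ x) ^ p = c) : g₀ =ᵐ[μ] g₁ := by
  have h2 : ∀ᵐ x ∂μ, g₁ x = c ^ p⁻¹ * g₀ x := by
    filter_upwards [h, h₀.pos, h₁.pos] with x hx a b
    rw [← hx, Real.rpow_rpow_inv (div_pos b a).le hp]
    field_simp
  have h3 : (1 : ℝ) = c ^ p⁻¹ := by
    rw [← h₁.integral_eq_one, integral_congr_ae h2, integral_const_mul, h₀.integral_eq_one, mul_one]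
  filter_upwards [h2] with x hx
  rw [hx, ← h3, one_mul]

theorem LFDSystem.multipliers_pos {Ω : Type*} [MeasurableSpace Ω] {μ : Measure Ω}
    {α ε₀ ε₁ u l₀ m₀ l₁ m₁ : ℝ} {f₀ f₁ g₀ g₁ : Ω → ℝ}
    (hf₀ : IsPosDensity μ f₀) (hf₁ : IsPosDensity μ f₁) (hu : u ∈ Set.Ioo (0 : ℝ) 1)
    (S : LFDSystem μ α f₀ f₁ ε₀ ε₁ u g₀ g₁ l₀ m₀ l₁ m₁) (hne : ¬ g₀ =ᵐ[μ] g₁) :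
    0 < l₀ ∧ 0 < l₁ := by
  obtain ⟨s₀, s₁⟩ := S.stationary hf₀ hf₁
  have hu0 : u ≠ 0 := hu.1.ne'
  have hu1 : 1 - u ≠ 0 := by linarith [hu.2]
  constructor
  · refine S.nonneg₀.lt_of_ne' fun hl => hne ?_
    refine S.density₀.ae_eq_of_div_rpow_const S.density₁ (p := u) (c := m₀ / (1 - u)) hu0 ?_
    filter_upwards [s₀] with x hx
    rw [hl, zero_mul, add_zero] at hx
    rw [← hx]
    field_simp
  · refine S.nonneg₁.lt_of_ne' fun hl => hne ?_
    refine S.density₀.ae_eq_of_div_rpow_const S.density₁ (p := u - 1) (c := m₁ / u)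
      (by linarith [hu.2]) ?_
    filter_upwards [s₁] with x hx
    rw [hl, zero_mul, add_zero] at hx
    rw [← hx]
    field_simp

theorem theorem5 {Ω : Type*} [MeasurableSpace Ω] (μ : Measure Ω) (α : ℝ) (hα₀ : α ≠ 0)
    (hα₁ : α ≠ 1) (f₀ f₁ : Ω → ℝ) (hf₀ : IsPosDensity μ f₀) (hf₁ : IsPosDensity μ f₁)
    (ε₀ ε₁ : ℝ) (hε₀ : 0 < ε₀) (hε₁ : 0 < ε₁) (u : ℝ) (hu : u ∈ Set.Ioo (0 : ℝ) 1) :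
    -- for fixed `u`, the coupled maximization problems are equivalent to the system
    (∀ g₀ g₁ : Ω → ℝ,
      SolvesMaximization μ (symmAlphaNhd μ α f₀ ε₀) (symmAlphaNhd μ α f₁ ε₁) u g₀ g₁ ↔
        ∃ l₀ m₀ l₁ m₁ : ℝ, LFDSystem μ α f₀ f₁ ε₀ ε₁ u g₀ g₁ l₀ m₀ l₁ m₁) ∧
    -- least favorable densities: the system, together with the minimization over the exponent
    (∀ g₀ g₁ : Ω → ℝ,
      IsLeastFavorable μ (symmAlphaNhd μ α f₀ ε₀) (symmAlphaNhd μ α f₁ ε₁) u g₀ g₁ ↔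
        (∃ l₀ m₀ l₁ m₁ : ℝ, LFDSystem μ α f₀ f₁ ε₀ ε₁ u g₀ g₁ l₀ m₀ l₁ m₁) ∧
          SolvesMinimization μ u g₀ g₁) ∧
    -- unless `g₀ = g₁`, multipliers are positive and both divergence constraints are equations
    (∀ (g₀ g₁ : Ω → ℝ) (l₀ m₀ l₁ m₁ : ℝ), LFDSystem μ α f₀ f₁ ε₀ ε₁ u g₀ g₁ l₀ m₀ l₁ m₁ →
      ¬ g₀ =ᵐ[μ] g₁ →
        0 < l₀ ∧ 0 < l₁ ∧ symmAlphaDiv μ α g₀ f₀ = ENNReal.ofReal ε₀ ∧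
          symmAlphaDiv μ α g₁ f₁ = ENNReal.ofReal ε₁) ∧
    -- unless `g₀ = g₁`, the densities are uniquely determined by the system
    (∀ (g₀ g₁ h₀ h₁ : Ω → ℝ) (l₀ m₀ l₁ m₁ l₀' m₀' l₁' m₁' : ℝ),
      LFDSystem μ α f₀ f₁ ε₀ ε₁ u g₀ g₁ l₀ m₀ l₁ m₁ →
      LFDSystem μ α f₀ f₁ ε₀ ε₁ u h₀ h₁ l₀' m₀' l₁' m₁' →
      ¬ g₀ =ᵐ[μ] g₁ → h₀ =ᵐ[μ] g₀ ∧ h₁ =ᵐ[μ] g₁) := by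
  have sys : ∀ {g₀ g₁ : Ω → ℝ},
      SolvesMaximization μ (symmAlphaNhd μ α f₀ ε₀) (symmAlphaNhd μ α f₁ ε₁) u g₀ g₁ →
        ∃ l₀ m₀ l₁ m₁ : ℝ, LFDSystem μ α f₀ f₁ ε₀ ε₁ u g₀ g₁ l₀ m₀ l₁ m₁ :=
    exists_lfdSystem_of_solvesMaximization hα₀ hα₁ hf₀ hf₁ hε₀ hε₁ hu
  refine ⟨fun g₀ g₁ => ⟨sys, ?_⟩, fun g₀ g₁ => ⟨?_, ?_⟩, ?_, ?_⟩
  · rintro ⟨l₀, m₀, l₁, m₁, S⟩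
    have M₀ : g₀ ∈ symmAlphaNhd μ α f₀ ε₀ := ⟨S.density₀, S.div₀⟩
    have M₁ : g₁ ∈ symmAlphaNhd μ α f₁ ε₁ := ⟨S.density₁, S.div₁⟩
    exact ⟨M₀, M₁, fun h₀ H₀ => (S.affinity_le hα₀ hα₁ hf₀ hf₁ hε₀ hε₁ hu H₀ M₁).1,
      fun h₁ H₁ => (S.affinity_le hα₀ hα₁ hf₀ hf₁ hε₀ hε₁ hu M₀ H₁).1⟩
  · intro L
    exact ⟨sys ⟨L.mem₀, L.mem₁, fun h₀ H₀ => L.max h₀ H₀ g₁ L.mem₁,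
      fun h₁ H₁ => L.max g₀ L.mem₀ h₁ H₁⟩, L.min⟩
  · rintro ⟨⟨l₀, m₀, l₁, m₁, S⟩, hmin⟩
    exact ⟨⟨S.density₀, S.div₀⟩, ⟨S.density₁, S.div₁⟩,
      fun h₀ H₀ h₁ H₁ => (S.affinity_le hα₀ hα₁ hf₀ hf₁ hε₀ hε₁ hu H₀ H₁).1, hmin⟩
  · intro g₀ g₁ l₀ m₀ l₁ m₁ S hne
    obtain ⟨p₀, p₁⟩ := S.multipliers_pos hf₀ hf₁ hu hne
    exact ⟨p₀, p₁, S.slack₀.resolve_left p₀.ne', S.slack₁.resolve_left p₁.ne'⟩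
  · intro g₀ g₁ h₀ h₁ l₀ m₀ l₁ m₁ l₀' m₀' l₁' m₁' S T hne
    obtain ⟨p₀, p₁⟩ := S.multipliers_pos hf₀ hf₁ hu hne
    have hS := (S.affinity_le hα₀ hα₁ hf₀ hf₁ hε₀ hε₁ hu
      ⟨T.density₀, T.div₀⟩ ⟨T.density₁, T.div₁⟩).2
    have hT := (T.affinity_le hα₀ hα₁ hf₀ hf₁ hε₀ hε₁ hu
      ⟨S.density₀, S.div₀⟩ ⟨S.density₁, S.div₁⟩).1
    exact ⟨(hS hT).1 p₀, (hS hT).2 p₁⟩
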